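/- Graphs are finite multigraphs, possibly with loops. Let $k,\ell$ be integers with $k\ge 0$ and $k\le\ell\le 2k-1$. A graph is *$(k,\ell)$-sparse* if every subgraph with $n'$ vertices and $m'\ge 1$ edges satisfies $m'\le kn'-\ell$; it is *$(k,\ell)$-tight* if, in addition, it has exactly $kn-\ell$ edges, where $n$ is its number of vertices. An *$\ell\mathsf{T}k$ decomposition* of a graph $G$ is a family $T_1,\dots,T_\ell$ of edge-disjoint trees in $G$ (each with at least one vertex, not necessarily spanning, possibly a single vertex) that together contain every edge of $G$ and such that each vertex of $G$ is in exactly $k$ of them. The *tree-pieces* in a subgraph $G'$ of $G$ are the connected components of $T_1\cap G',\dots,T_\ell\cap G'$ (single vertices included, and counted separately for each $i$). The decomposition is *proper* if there are at least $\ell$ tree-pieces in every subgraph $G'$ of $G$ with at least two vertices. A graph is a *proper $\ell\mathsf{T}k$* if it has a proper $\ell\mathsf{T}k$ decomposition. **Corollary (Crapo, Haas).** Let $k\le\ell\le 2k-1$. A graph $G$ is $(k,\ell)$-tight if and only if it is a proper $\ell\mathsf{T}k$. (The case $(k,\ell)=(2,3)$ is Crapo's characterization of Laman graphs, that is, $(2,3)$-tight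 graphs, as the proper $3\mathsf{T}2$ graphs.) -/

import Mathlib

namespace TreeDecomp

/-- Two vertices are joined by a (possibly trivial) walk. -/
def Reachable {α β : Type*} (G : Graph α β) : α → α → Prop :=
  Relation.ReflTransGen G.Adj

/-- The connected components of a multigraph, as sets of vertices. -/
def components {α β : Type*} (G : Graph α β) : Set (Set α) :=
  {C | ∃ x ∈ G.vertexSet, C = {y | Reachable G x y}}

/-- A multigraph is connected if it has a vertex and any two vertices are joined by a walk. -/
def IsConnected {α β : Type*} (G : Graph α β) : Prop :=
  G.vertexSet.Nonempty ∧ ∀ x ∈ G.vertexSet, ∀ y ∈ G.vertexSet, Reachable G x y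

/-- A multigraph is acyclic if no edge lies on a cycle: the ends of an edge are never joined
by a walk that avoids this edge. In particular there are no loops (the trivial walk avoids the
loop) and no parallel edges. -/
def IsAcyclic {α β : Type*} (G : Graph α β) : Prop :=
  ∀ e x y, G.IsLink e x y → ¬ Reachable (G.deleteEdges {e}) x y

/-- A tree is a connected acyclic multigraph (with at least one vertex). -/
def IsTree {α β : Type*} (G : Graph α β) : Prop :=
  IsConnected G ∧ IsAcyclic G

/-- `G` is `(k, ℓ)`-sparse: every subgraph with `n'` vertices and `m' ≥ 1` edges
satisfies `m' ≤ k n' - ℓ`. -/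
def IsSparse {α β : Type*} (k l : ℕ) (G : Graph α β) : Prop :=
  ∀ H : Graph α β, H ≤ G → H.edgeSet.Nonempty →
    (H.edgeSet.ncard : ℤ) ≤ (k : ℤ) * (H.vertexSet.ncard : ℤ) - (l : ℤ)

/-- `G` is `(k, ℓ)`-tight: it is `(k, ℓ)`-sparse and has exactly `k n - ℓ` edges,
where `n` is its number of vertices. -/
def IsTight {α β : Type*} (k l : ℕ) (G : Graph α β) : Prop :=
  IsSparse k l G ∧
    (G.edgeSet.ncard : ℤ) = (k : ℤ) * (G.vertexSet.ncard : ℤ) - (l : ℤ)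

/-- An `ℓTk` decomposition of `G`: a family of `ℓ` edge-disjoint trees in `G` (not necessarily
spanning, possibly single vertices) that together contain every edge of `G`, such that each
vertex of `G` is in exactly `k` of them. -/
structure IsTreeDecomposition {α β : Type*} (k l : ℕ) (G : Graph α β)
    (T : Fin l → Graph α β) : Prop where
  le : ∀ i, T i ≤ G
  isTree : ∀ i, IsTree (T i)
  edge_disjoint : ∀ i j, i ≠ j → Disjoint (T i).edgeSet (T j).edgeSet
  edge_cover : ∀ e ∈ G.edgeSet, ∃ i, e ∈ (T i).edgeSet
  vertex_count : ∀ v ∈ G.vertexSet, {i | v ∈ (T i).vertexSet}.ncard = k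

/-- The number of tree-pieces in the subgraph `H`: the trees `T i` are restricted to `H`, and
the connected components of these restrictions (single vertices included) are counted, tree by
tree. -/
noncomputable def numTreePieces {α β : Type*} {l : ℕ} (T : Fin l → Graph α β)
    (H : Graph α β) : ℕ :=
  ∑ i, (components (T i ⊓ H)).ncard

/-- The family `T` is proper in `G`: there are at least `ℓ` tree-pieces in every subgraph of `G`
with at least two vertices. -/
def IsProper {α β : Type*} {l : ℕ} (G : Graph α β) (T : Fin l → Graph α β) : Prop :=
  ∀ H : Graph α β, H ≤ G → H.vertexSet.Nontrivial → l ≤ numTreePieces T H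

/-- `G` is a proper `ℓTk`: it has a proper `ℓTk` decomposition. -/
def IsProperLTk {α β : Type*} (k l : ℕ) (G : Graph α β) : Prop :=
  ∃ T : Fin l → Graph α β, IsTreeDecomposition k l G T ∧ IsProper G T

end TreeDecomp

/-! For a fixed decomposition `T` and a subgraph `H`, each `T i ⊓ H` is a forest, so its edges and
components together number as many as its vertices. Summing over `i` gives pieces + m' = k n'
(`numTreePieces_add_ncard_edgeSet`). So "at least l pieces" and "m' ≤ k n' - l" are the same
inequality, and `H = G`, where every tree is one piece, gives the tight edge count. An edgeless `H`
with two or more vertices has k n' ≥ 2k > l pieces.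

It remains to decompose a tight graph. As l ≥ k, sparsity gives m' ≤ k (n' - 1), so the edges split
into k forests (`exists_forest_partition`). Taken as spanning forests they have kn - m = l
components, and these are the trees. The partition comes from Rado's theorem applied to k copies of
the graphic matroid, with rank computed from incidence vectors over `ZMod 2`. -/

namespace TreeDecomp

open Submodule Finsupp

variable {α β : Type*} {G H : Graph α β}

/-! ### Reachability and components -/

lemma Reachable.symm {x y : α} (h : Reachable G x y) : Reachable G y x :=
  Relation.ReflTransGen.stdSymm.symm _ _ h

lemma Reachable.mono (hle : H ≤ G) {x y : α} (h : Reachable H x y) : Reachable G x y :=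
  Relation.ReflTransGen.mono (fun _ _ h ↦ h.mono hle) _ _ h

lemma Reachable.mem {x y : α} (h : Reachable G x y) (hx : x ∈ G.vertexSet) :
    y ∈ G.vertexSet := by
  induction h with
  | refl => exact hx
  | tail _ h _ => exact h.right_mem

lemma _root_.Graph.IsLink.reachable {e : β} {x y : α} (h : G.IsLink e x y) : Reachable G x y :=
  .single ⟨e, h⟩

/-- The set of vertices reachable from `x`. -/
def componentOf (G : Graph α β) (x : α) : Set α := {y | Reachable G x y}

lemma componentOf_eq_of_reachable {x y : α} (h : Reachable G x y) :
    componentOf G x = componentOf G y :=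
  Set.ext fun _ ↦ ⟨fun hz ↦ h.symm.trans hz, fun hz ↦ h.trans hz⟩

lemma mem_componentOf_self (G : Graph α β) (x : α) : x ∈ componentOf G x := .refl

lemma componentOf_mem_components {x : α} (hx : x ∈ G.vertexSet) :
    componentOf G x ∈ components G := ⟨x, hx, rfl⟩

lemma components_eq_image (G : Graph α β) : components G = componentOf G '' G.vertexSet := by
  ext C
  exact ⟨fun ⟨x, hx, h⟩ ↦ ⟨x, hx, h.symm⟩, fun ⟨x, hx, h⟩ ↦ ⟨x, hx, h.symm⟩⟩

lemma finite_components (hV : G.vertexSet.Finite) : (components G).Finite := by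
  rw [components_eq_image]
  exact hV.image _

lemma componentOf_eq_of_mem {C : Set α} (hC : C ∈ components G) {x : α} (hx : x ∈ C) :
    componentOf G x = C := by
  obtain ⟨y, hy, rfl⟩ := hC
  exact (componentOf_eq_of_reachable hx).symm

lemma subset_vertexSet_of_mem_components {C : Set α} (hC : C ∈ components G) :
    C ⊆ G.vertexSet := by
  obtain ⟨y, hy, rfl⟩ := hC
  exact fun x hx ↦ Reachable.mem hx hy

lemma nonempty_of_mem_components {C : Set α} (hC : C ∈ components G) : C.Nonempty := by
  obtain ⟨y, hy, rfl⟩ := hC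
  exact ⟨y, .refl⟩

/-! ### Graphic matroid over the field with two elements -/

/-- `v` assigns to every edge of `G` its incidence vector over the field with two elements. -/
def IsIncidence (G : Graph α β) (v : β → α →₀ ZMod 2) : Prop :=
  ∀ e x y, G.IsLink e x y → v e = single x 1 + single y 1

lemma exists_isIncidence (G : Graph α β) : ∃ v, IsIncidence G v := by
  have h : ∀ e, ∃ w : α →₀ ZMod 2, ∀ x y, G.IsLink e x y → w = single x 1 + single y 1 := by
    intro e
    by_cases he : e ∈ G.edgeSet
    · obtain ⟨x, y, hxy⟩ := G.exists_isLink_of_mem_edgeSet he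
      refine ⟨single x 1 + single y 1, fun x' y' h ↦ ?_⟩
      obtain ⟨rfl, rfl⟩ | ⟨rfl, rfl⟩ := hxy.eq_and_eq_or_eq_and_eq h
      · rfl
      · exact add_comm _ _
    · exact ⟨0, fun x y h ↦ (he h.edge_mem).elim⟩
  choose v hv using h
  exact ⟨v, hv⟩

lemma IsIncidence.mono {v : β → α →₀ ZMod 2} (hv : IsIncidence G v) (hle : H ≤ G) :
    IsIncidence H v := fun e x y h ↦ hv e x y (h.mono hle)

lemma finrank_span_image_eq_ncard {K M ι : Type*} [Field K] [AddCommGroup M] [Module K M]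
    {f : ι → M} {s : Set ι} (h : LinearIndepOn K f s) :
    Module.finrank K (span K (f '' s)) = s.ncard := by
  rw [← h.injOn.ncard_image, Module.finrank, rank_span_set h.id_image]
  rfl

lemma finrank_map_add_finrank_inf_ker {K M N : Type*} [Field K] [AddCommGroup M] [Module K M]
    [AddCommGroup N] [Module K N] (f : M →ₗ[K] N) (W : Submodule K M) [FiniteDimensional K W] :
    Module.finrank K (W.map f) + Module.finrank K (W ⊓ LinearMap.ker f : Submodule K M) =
      Module.finrank K W := by
  rw [← LinearMap.finrank_range_add_finrank_ker (f.domRestrict W), LinearMap.range_domRestrict,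
    LinearMap.ker_domRestrict, ← Submodule.map_comap_subtype,
    (equivMapOfInjective W.subtype W.injective_subtype _).finrank_eq]

lemma finrank_span_single (s : Set α) :
    Module.finrank (ZMod 2) (span (ZMod 2) ((fun a ↦ single a (1 : ZMod 2)) '' s)) = s.ncard :=
  finrank_span_image_eq_ncard ((Finsupp.linearIndependent_single_one (ZMod 2) α).linearIndepOn s)

lemma add_self_finsupp (w : α →₀ ZMod 2) : w + w = 0 := by
  ext; simp [CharTwo.add_self_eq_zero]

/-- The incidence vectors along a walk telescope: inner vertices cancel mod 2. -/
lemma Reachable.single_add_single_mem {v : β → α →₀ ZMod 2} (hv : IsIncidence G v) {x y : α}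
    (h : Reachable G x y) :
    single x 1 + single y 1 ∈ span (ZMod 2) (v '' G.edgeSet) := by
  induction h with
  | refl => simp [add_self_finsupp]
  | @tail y z _ h ih =>
    obtain ⟨e, he⟩ := h
    have h2 : v e ∈ span (ZMod 2) (v '' G.edgeSet) :=
      subset_span ⟨e, he.edge_mem, rfl⟩
    rw [hv e y z he] at h2
    have := add_mem ih h2
    rwa [add_assoc, ← add_assoc (single y 1), add_self_finsupp, zero_add] at this

/-- The linear map summing the coordinates of a vector over each component. -/
noncomputable def componentSum (G : Graph α β) : (α →₀ ZMod 2) →ₗ[ZMod 2] (Set α →₀ ZMod 2) :=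
  lmapDomain (ZMod 2) (ZMod 2) (componentOf G)

lemma componentSum_single (G : Graph α β) (x : α) :
    componentSum G (single x 1) = single (componentOf G x) 1 := by
  simp [componentSum]

lemma componentSum_incidence {v : β → α →₀ ZMod 2} (hv : IsIncidence G v) {e : β}
    (he : e ∈ G.edgeSet) : componentSum G (v e) = 0 := by
  obtain ⟨x, y, hxy⟩ := G.exists_isLink_of_mem_edgeSet he
  rw [hv e x y hxy, map_add, componentSum_single, componentSum_single,
    componentOf_eq_of_reachable hxy.reachable, add_self_finsupp]

/-- Within the space `W` spanned by the vertices, the incidence vectors span exactly the kernel of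
`componentSum`, whose image has one dimension per component; rank-nullity finishes. -/
theorem finrank_span_add_ncard_components {v : β → α →₀ ZMod 2} (hv : IsIncidence G v)
    (hV : G.vertexSet.Finite) :
    Module.finrank (ZMod 2) (span (ZMod 2) (v '' G.edgeSet)) + (components G).ncard =
      G.vertexSet.ncard := by
  classical
  set W := span (ZMod 2) ((fun a ↦ single a (1 : ZMod 2)) '' G.vertexSet) with hW
  set B := span (ZMod 2) (v '' G.edgeSet) with hB
  have hBW : B ≤ W := by
    rw [hB, span_le]
    rintro _ ⟨e, he, rfl⟩
    obtain ⟨x, y, hxy⟩ := G.exists_isLink_of_mem_edgeSet he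
    rw [hv e x y hxy]
    exact add_mem (subset_span ⟨x, hxy.left_mem, rfl⟩) (subset_span ⟨y, hxy.right_mem, rfl⟩)
  have hBker : B ≤ LinearMap.ker (componentSum G) := by
    rw [hB, span_le]
    rintro _ ⟨e, he, rfl⟩
    exact componentSum_incidence hv he
  -- `S` sends a component to a chosen representative vertex, so `w + S (componentSum w)` lies in
  -- `B` for all `w` in `W`; on the kernel the second term vanishes.
  let S : (Set α →₀ ZMod 2) →ₗ[ZMod 2] (α →₀ ZMod 2) := linearCombination (ZMod 2)
    (fun C ↦ if h : C.Nonempty then single h.some 1 else 0)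
  have hS : W ≤ B.comap (LinearMap.id + S ∘ₗ componentSum G) := by
    rw [hW, span_le]
    rintro _ ⟨x, hx, rfl⟩
    have hne : (componentOf G x).Nonempty := ⟨x, .refl⟩
    have : S (componentSum G (single x 1)) = single hne.some 1 := by
      simp [S, componentSum_single, hne]
    simp only [comap_coe, Set.mem_preimage, LinearMap.add_apply, LinearMap.id_apply,
      LinearMap.comp_apply, this]
    exact Reachable.single_add_single_mem hv hne.some_mem
  have hBeq : B = W ⊓ LinearMap.ker (componentSum G) := by
    refine le_antisymm (le_inf hBW hBker) fun w ⟨hw, hw0⟩ ↦ ?_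
    have := hS hw
    simpa [LinearMap.mem_ker.1 hw0] using this
  have hmap : W.map (componentSum G) =
      span (ZMod 2) ((fun a ↦ single a (1 : ZMod 2)) '' components G) := by
    rw [hW, map_span, components_eq_image, Set.image_image, Set.image_image]
    simp only [componentSum_single]
  have : FiniteDimensional (ZMod 2) W := FiniteDimensional.span_of_finite _ (hV.image _)
  have h := finrank_map_add_finrank_inf_ker (componentSum G) W
  rwa [hmap, finrank_span_single, finrank_span_single, ← hBeq, add_comm] at h

lemma IsAcyclic.mono (hG : IsAcyclic G) (hle : H ≤ G) : IsAcyclic H := fun e x y h h' ↦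
  hG e x y (h.mono hle) (h'.mono (Graph.deleteEdges_mono_left hle {e}))

lemma deleteEdges_edgeSet_eq (G : Graph α β) (e : β) :
    (G.deleteEdges {e}).edgeSet = G.edgeSet \ {e} := by
  simp

/-- The vector of `e` lies in the span of the others exactly when its ends are joined avoiding `e`:
a walk telescopes, and otherwise `componentSum` after deleting `e` kills the other vectors but not
that of `e`. -/
lemma isAcyclic_iff_linearIndepOn {v : β → α →₀ ZMod 2} (hv : IsIncidence G v) :
    IsAcyclic G ↔ LinearIndepOn (ZMod 2) v G.edgeSet := by
  rw [linearIndepOn_iff_notMem_span]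
  constructor
  · intro h e he hmem
    obtain ⟨x, y, hxy⟩ := G.exists_isLink_of_mem_edgeSet he
    have hv' : IsIncidence (G.deleteEdges {e}) v := hv.mono (Graph.deleteEdges_le)
    have hle : span (ZMod 2) (v '' (G.edgeSet \ {e})) ≤
        LinearMap.ker (componentSum (G.deleteEdges {e})) := by
      rw [span_le]
      rintro _ ⟨f, hf, rfl⟩
      exact componentSum_incidence hv' (by rwa [deleteEdges_edgeSet_eq])
    have h0 := hle hmem
    rw [LinearMap.mem_ker, hv e x y hxy, map_add, componentSum_single, componentSum_single] at h0
    by_cases heq : componentOf (G.deleteEdges {e}) x = componentOf (G.deleteEdges {e}) y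
    · have := mem_componentOf_self (G.deleteEdges {e}) y
      rw [← heq] at this
      exact h e x y hxy this
    · have := DFunLike.congr_fun h0 (componentOf (G.deleteEdges {e}) x)
      simp [Ne.symm heq] at this
  · intro h e x y hxy hr
    refine h e hxy.edge_mem ?_
    rw [hv e x y hxy, ← deleteEdges_edgeSet_eq]
    exact Reachable.single_add_single_mem (hv.mono Graph.deleteEdges_le) hr

theorem IsAcyclic.ncard_edgeSet_add_ncard_components (hG : IsAcyclic G)
    (hV : G.vertexSet.Finite) :
    G.edgeSet.ncard + (components G).ncard = G.vertexSet.ncard := by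
  obtain ⟨v, hv⟩ := exists_isIncidence G
  rw [← finrank_span_image_eq_ncard ((isAcyclic_iff_linearIndepOn hv).1 hG),
    finrank_span_add_ncard_components hv hV]

/-! ### Rado's theorem -/

open Finset in
/-- **Rado's theorem** for monotone submodular functions: a family of finite sets satisfying the
Hall-type condition `|J| ≤ f (⋃ j ∈ J, A j)` has a system of representatives all of whose
subfamilies satisfy `|J| ≤ f (φ '' J)`. -/
theorem exists_transversal_of_submodular {ι X : Type*} [Finite ι] [DecidableEq ι] [DecidableEq X]
    (f : Finset X → ℕ) (f_empty : f ∅ = 0) (f_mono : Monotone f)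
    (f_submod : ∀ S T, f (S ∪ T) + f (S ∩ T) ≤ f S + f T)
    (A : ι → Finset X) (hA : ∀ J : Finset ι, #J ≤ f (J.biUnion A)) :
    ∃ φ : ι → X, (∀ i, φ i ∈ A i) ∧ ∀ J : Finset ι, #J ≤ f (J.image φ) := by
  have := Fintype.ofFinite ι
  induction hn : ∑ i, #(A i) using Nat.strong_induction_on generalizing A with
  | _ n ih =>
  subst hn
  by_cases hone : ∀ i, #(A i) ≤ 1
  · have hex : ∀ i, ∃ x, A i = {x} := by
      intro i
      refine card_eq_one.1 (le_antisymm (hone i) ?_)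
      rw [Nat.one_le_iff_ne_zero, Ne, card_eq_zero]
      intro h0
      have := hA {i}
      simp [h0, f_empty] at this
    choose φ hφ using hex
    refine ⟨φ, fun i ↦ by simp [hφ], fun J ↦ ?_⟩
    convert hA J
    ext x
    simp [hφ, eq_comm]
  push Not at hone
  obtain ⟨i, hi⟩ := hone
  obtain ⟨x, hx, y, hy, hxy⟩ := one_lt_card.1 hi
  -- Induction on the total size: `A i` can shrink by `z` unless the Hall condition breaks.
  have key : ∀ z ∈ A i, (∀ J : Finset ι, #J ≤ f (J.biUnion (Function.update A i ((A i).erase z)))) →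
      ∃ φ : ι → X, (∀ i, φ i ∈ A i) ∧ ∀ J : Finset ι, #J ≤ f (J.image φ) := by
    intro z hz hJ
    have hle : ∀ j, Function.update A i ((A i).erase z) j ⊆ A j := by
      intro j
      by_cases hj : j = i
      · subst hj; simpa using erase_subset _ _
      · simp [hj]
    obtain ⟨φ, hφ, h⟩ := ih _ (sum_lt_sum (fun j _ ↦ card_le_card (hle j))
      ⟨i, mem_univ i, by simpa using card_erase_lt_of_mem hz⟩) _ hJ rfl
    exact ⟨φ, fun j ↦ hle j (hφ j), h⟩
  have viol : ∀ z, (¬ ∀ J : Finset ι, #J ≤ f (J.biUnion (Function.update A i ((A i).erase z)))) →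
      ∃ J : Finset ι, i ∉ J ∧ f ((A i).erase z ∪ J.biUnion A) ≤ #J := by
    intro z hz
    push Not at hz
    obtain ⟨J, hJ⟩ := hz
    have hcongr : ∀ J' : Finset ι, i ∉ J' →
        J'.biUnion (Function.update A i ((A i).erase z)) = J'.biUnion A := by
      intro J' hi'
      refine biUnion_congr rfl fun j hj ↦ ?_
      rw [Function.update_of_ne (ne_of_mem_of_not_mem hj hi')]
    by_cases hiJ : i ∈ J
    · refine ⟨J.erase i, notMem_erase _ _, ?_⟩
      rw [← insert_erase hiJ, biUnion_insert, hcongr _ (notMem_erase _ _),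
        card_insert_of_notMem (notMem_erase _ _), Function.update_self] at hJ
      omega
    · rw [hcongr J hiJ] at hJ
      exact absurd (hA J) (by omega)
  by_contra hcon
  obtain ⟨J₁, hi₁, h₁⟩ := viol x fun h ↦ hcon (key x hx h)
  obtain ⟨J₂, hi₂, h₂⟩ := viol y fun h ↦ hcon (key y hy h)
  -- As `x ≠ y`, the union of the two sets contains all of `A i`. The Hall condition then gains 1
  -- over |J₁ ∪ J₂| + |J₁ ∩ J₂|, contradicting submodularity.
  have hsub := f_submod ((A i).erase x ∪ J₁.biUnion A) ((A i).erase y ∪ J₂.biUnion A)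
  have hU : #(insert i (J₁ ∪ J₂)) ≤
      f (((A i).erase x ∪ J₁.biUnion A) ∪ ((A i).erase y ∪ J₂.biUnion A)) := by
    refine (hA _).trans (f_mono fun z hz ↦ ?_)
    simp only [mem_biUnion, mem_insert, mem_union, mem_erase] at hz ⊢
    grind
  have hI : #(J₁ ∩ J₂) ≤
      f (((A i).erase x ∪ J₁.biUnion A) ∩ ((A i).erase y ∪ J₂.biUnion A)) := by
    refine (hA _).trans (f_mono fun z hz ↦ ?_)
    simp only [mem_biUnion, mem_inter, mem_union, mem_erase] at hz ⊢
    grind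
  rw [card_insert_of_notMem (by simp [hi₁, hi₂])] at hU
  have := card_union_add_card_inter J₁ J₂
  omega

/-! ### Partition into forests -/

lemma sum_ncard_components (hV : G.vertexSet.Finite) :
    ∑ C ∈ (finite_components hV).toFinset, C.ncard = G.vertexSet.ncard := by
  classical
  rw [Set.ncard_eq_toFinset_card _ hV, Finset.card_eq_sum_card_fiberwise (f := componentOf G)
    (t := (finite_components hV).toFinset)]
  · refine Finset.sum_congr rfl fun C hC ↦ ?_
    rw [Set.Finite.mem_toFinset] at hC
    rw [← Set.ncard_coe_finset]
    congr 1
    ext x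
    simp only [Finset.coe_filter, Set.Finite.mem_toFinset, Set.mem_ofPred_eq]
    refine ⟨fun hx ↦ ⟨subset_vertexSet_of_mem_components hC hx, componentOf_eq_of_mem hC hx⟩, ?_⟩
    rintro ⟨-, rfl⟩
    exact mem_componentOf_self G x
  · intro x hx
    simpa using componentOf_mem_components (by simpa using hx)

lemma ncard_edgeSet_le_sum_components (hV : G.vertexSet.Finite) :
    G.edgeSet.ncard ≤
      ∑ C ∈ (finite_components hV).toFinset, (G.induce C).edgeSet.ncard := by
  have : G.edgeSet = ⋃ C ∈ (finite_components hV).toFinset, (G.induce C).edgeSet := by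
    ext e
    simp only [Set.mem_iUnion, Set.Finite.mem_toFinset, Graph.edgeSet_induce, exists_prop]
    constructor
    · intro he
      obtain ⟨x, y, hxy⟩ := G.exists_isLink_of_mem_edgeSet he
      exact ⟨_, componentOf_mem_components hxy.left_mem, x, y, hxy, mem_componentOf_self G x,
        hxy.reachable⟩
    · rintro ⟨C, -, x, y, hxy, -⟩
      exact hxy.edge_mem
  conv_lhs => rw [this]
  exact Finset.set_ncard_biUnion_le _ _

/-- If every subgraph of `G` with an edge has at most `k (n' - 1)` edges, then every set of edges
has size at most `k` times its rank. -/
lemma ncard_le_mul_finrank_span {k : ℕ} (hV : G.vertexSet.Finite)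
    (hG : ∀ H ≤ G, H.edgeSet.Nonempty → H.edgeSet.ncard + k ≤ k * H.vertexSet.ncard)
    {v : β → α →₀ ZMod 2} (hv : IsIncidence G v) {J : Set β} (hJ : J ⊆ G.edgeSet) :
    J.ncard ≤ k * Module.finrank (ZMod 2) (span (ZMod 2) (v '' J)) := by
  set H := G.restrict J with hH
  have hHG : H ≤ G := G.restrict_le
  have hEH : H.edgeSet = J := by simpa [hH] using hJ
  have hVH : H.vertexSet.Finite := hV.subset hHG.vertexSet_mono
  have hrank := finrank_span_add_ncard_components (hv.mono hHG) hVH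
  have hle := ncard_edgeSet_le_sum_components hVH
  -- An edgeless component satisfies the bound too, since it is nonempty. The sum over the c
  -- components reads m + k c ≤ k n, and the rank is n - c.
  have hcomp : ∑ C ∈ (finite_components hVH).toFinset, ((H.induce C).edgeSet.ncard + k) ≤
      ∑ C ∈ (finite_components hVH).toFinset, k * C.ncard := by
    refine Finset.sum_le_sum fun C hC ↦ ?_
    rw [Set.Finite.mem_toFinset] at hC
    have hsub := subset_vertexSet_of_mem_components hC
    by_cases hne : (H.induce C).edgeSet.Nonempty
    · exact hG _ ((Graph.induce_le hsub).trans hHG) hne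
    · rw [Set.not_nonempty_iff_eq_empty] at hne
      have : 0 < C.ncard :=
        (Set.ncard_pos (hVH.subset hsub)).2 (nonempty_of_mem_components hC)
      rw [hne, Set.ncard_empty, zero_add]
      exact Nat.le_mul_of_pos_right k this
  rw [Finset.sum_add_distrib, ← Finset.mul_sum, sum_ncard_components hVH, Finset.sum_const,
    smul_eq_mul,
    ← Set.ncard_eq_toFinset_card _ (finite_components hVH), ← hrank, hEH] at hcomp
  rw [hEH] at hle
  nlinarith

lemma linearIndepOn_of_ncard_le {K M ι : Type*} [Field K] [AddCommGroup M] [Module K M]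
    {f : ι → M} {s : Set ι} (hs : s.Finite)
    (h : s.ncard ≤ Module.finrank K (span K (f '' s))) : LinearIndepOn K f s := by
  have := hs.fintype
  rw [LinearIndepOn, linearIndependent_iff_card_le_finrank_span, Set.finrank,
    ← Nat.card_eq_fintype_card, Nat.card_coe_set_eq,
    ← Set.image_eq_range]
  exact h

lemma finrank_span_image_union_add_inter_le {K M ι : Type*} [Field K] [AddCommGroup M]
    [Module K M] (f : ι → M) {s t : Set ι} (hs : s.Finite) (ht : t.Finite) :
    Module.finrank K (span K (f '' (s ∪ t))) + Module.finrank K (span K (f '' (s ∩ t))) ≤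
      Module.finrank K (span K (f '' s)) + Module.finrank K (span K (f '' t)) := by
  have := FiniteDimensional.span_of_finite K (hs.image f)
  have := FiniteDimensional.span_of_finite K (ht.image f)
  rw [← Submodule.finrank_sup_add_finrank_inf_eq (span K (f '' s)), Set.image_union, span_union]
  gcongr
  exact Submodule.finrank_mono (le_inf (span_mono (Set.image_mono Set.inter_subset_left))
    (span_mono (Set.image_mono Set.inter_subset_right)))

/-- **Nash-Williams' arboricity theorem**: if every subgraph of `G` with an edge has at most
`k (n' - 1)` edges, then the edge set of `G` can be partitioned into `k` forests. -/
theorem exists_forest_partition {k : ℕ} (hV : G.vertexSet.Finite) (hE : G.edgeSet.Finite)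
    (hG : ∀ H ≤ G, H.edgeSet.Nonempty → H.edgeSet.ncard + k ≤ k * H.vertexSet.ncard) :
    ∃ F : Fin k → Set β, (∀ i j, i ≠ j → Disjoint (F i) (F j)) ∧ ⋃ i, F i = G.edgeSet ∧
      ∀ i, IsAcyclic (G.restrict (F i)) := by
  classical
  obtain ⟨v, hv⟩ := exists_isIncidence G
  let r : Set β → ℕ := fun S ↦ Module.finrank (ZMod 2) (span (ZMod 2) (v '' S))
  have r_empty : r ∅ = 0 := by
    simpa using finrank_span_image_eq_ncard (linearIndepOn_empty (ZMod 2) v)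
  -- Elements are pairs (edge, colour); a set of pairs is measured by the sum of the ranks of its
  -- colour classes.
  let slice : Finset (G.edgeSet × Fin k) → Fin k → Set β := fun S j ↦ {e | ∃ h, (⟨e, h⟩, j) ∈ S}
  have hslice : ∀ S j, (slice S j).Finite := fun S j ↦ hE.subset fun e ⟨h, _⟩ ↦ h
  have r_mono : ∀ {S T : Set β}, T.Finite → S ⊆ T → r S ≤ r T := fun hT hST ↦
    have := FiniteDimensional.span_of_finite (ZMod 2) (hT.image v)
    Submodule.finrank_mono (span_mono (Set.image_mono hST))
  have : Finite G.edgeSet := hE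
  have := Fintype.ofFinite G.edgeSet
  obtain ⟨φ, hφ, hind⟩ := exists_transversal_of_submodular (ι := G.edgeSet)
    (fun S ↦ ∑ j, r (slice S j)) (by simp [slice, r_empty])
    (fun S T hST ↦ Finset.sum_le_sum fun j _ ↦ r_mono (hslice T j) fun e ⟨h, he⟩ ↦ ⟨h, hST he⟩)
    (fun S T ↦ by
      rw [← Finset.sum_add_distrib, ← Finset.sum_add_distrib]
      refine Finset.sum_le_sum fun j _ ↦ ?_
      have hU : slice (S ∪ T) j = slice S j ∪ slice T j := by
        ext e; simp [slice, exists_or]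
      have hI : slice (S ∩ T) j = slice S j ∩ slice T j := by
        ext e
        simp only [slice, Finset.mem_inter, Set.mem_ofPred_eq, Set.mem_inter_iff]
        exact ⟨fun ⟨h, h₁, h₂⟩ ↦ ⟨⟨h, h₁⟩, ⟨h, h₂⟩⟩, fun ⟨⟨h, h₁⟩, ⟨_, h₂⟩⟩ ↦ ⟨h, h₁, h₂⟩⟩
      rw [hU, hI]
      exact finrank_span_image_union_add_inter_le v (hslice S j) (hslice T j))
    -- Each edge may take any colour, so every slice over `J` is `J` itself and the Hall condition
    -- becomes |J| ≤ k r(J).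
    (fun e ↦ {e} ×ˢ Finset.univ)
    (fun J ↦ by
      have h : ∀ j, slice (J.biUnion fun e ↦ {e} ×ˢ Finset.univ) j = (↑) '' (J : Set G.edgeSet) := by
        intro j
        ext e
        simp [slice]
      simp only [h, Finset.sum_const, Finset.card_univ, Fintype.card_fin, smul_eq_mul]
      rw [← Set.ncard_coe_finset, ← Set.ncard_image_of_injective _ Subtype.val_injective]
      exact ncard_le_mul_finrank_span hV hG hv (by rintro _ ⟨e, -, rfl⟩; exact e.2))
  have hφ' : ∀ e, (φ e).1 = e := by
    intro e
    obtain ⟨a, ha⟩ : ∃ a, (e, a) = φ e := by simpa using hφ e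
    rw [← ha]
  let F : Fin k → Set β := fun i ↦ {e | ∃ h : e ∈ G.edgeSet, (φ ⟨e, h⟩).2 = i}
  have hFE : ∀ i, F i ⊆ G.edgeSet := fun i e ⟨h, _⟩ ↦ h
  refine ⟨F, ?_, ?_, fun i ↦ ?_⟩
  · intro i j hij
    rw [Set.disjoint_left]
    rintro e ⟨h, hi⟩ ⟨_, hj⟩
    exact hij (hi.symm.trans hj)
  · ext e
    simp [F]
  rw [isAcyclic_iff_linearIndepOn (hv.mono Graph.restrict_le)]
  have hEF : (G.restrict (F i)).edgeSet = F i := by simpa using hFE i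
  rw [hEF]
  refine linearIndepOn_of_ncard_le (hE.subset (hFE i)) ?_
  -- For the edges of colour `i`, only slice `i` of the image is nonempty; the bound becomes |F i| ≤
  -- r(F i), which is independence.
  have hJ := hind (Finset.univ.filter fun e ↦ (φ e).2 = i)
  have himg : F i = (↑) '' ((Finset.univ.filter fun e ↦ (φ e).2 = i : Finset G.edgeSet) :
      Set G.edgeSet) := by
    ext e; simp [F]
  have hsl : ∀ j, slice ((Finset.univ.filter fun e ↦ (φ e).2 = i).image φ) j =
      if j = i then F i else ∅ := by
    intro j
    ext e
    simp only [slice, Finset.mem_image, Finset.mem_filter, Finset.mem_univ, true_and,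
      Set.mem_ofPred_eq]
    constructor
    · rintro ⟨h, a, ha, hae⟩
      have h1 := hφ' a
      rw [hae] at h1 ha
      subst h1
      simp only at ha
      subst ha
      simp only [if_true]
      exact ⟨h, by rw [hae]⟩
    · split_ifs with hji
      · rintro ⟨h, he⟩
        exact ⟨h, ⟨e, h⟩, he, Prod.ext (hφ' _) (he.trans hji.symm)⟩
      · simp
  rw [← Set.ncard_coe_finset, ← Set.ncard_image_of_injective _ Subtype.val_injective, ← himg] at hJ
  simp only [hsl] at hJ
  rw [Finset.sum_eq_single i (by intro j _ hj; simp [hj, r_empty]) (by simp)] at hJ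
  simpa using hJ

/-! ### Counting tree-pieces -/

/-- Double counting: if every element of `S` lies in exactly `k` members of a family, the traces
of the family on `S` have total size `k |S|`. -/
lemma sum_ncard_inter_eq {ι X : Type*} [Fintype ι] {A : ι → Set X} {S : Set X} (hS : S.Finite)
    {k : ℕ} (h : ∀ x ∈ S, {i | x ∈ A i}.ncard = k) : ∑ i, (A i ∩ S).ncard = k * S.ncard := by
  classical
  have h₁ : ∀ i, (A i ∩ S).ncard = ∑ x ∈ hS.toFinset, if x ∈ A i then 1 else 0 := by
    intro i
    rw [← Finset.card_filter, ← Set.ncard_coe_finset]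
    congr 1
    ext x
    simp [and_comm]
  have h₂ : ∀ x ∈ hS.toFinset, (∑ i, if x ∈ A i then 1 else 0) = k := by
    intro x hx
    rw [← Finset.card_filter, ← Set.ncard_coe_finset, ← h x (by simpa using hx)]
    congr 1
    ext i
    simp
  simp only [h₁]
  rw [Finset.sum_comm, Finset.sum_congr rfl h₂, Finset.sum_const, smul_eq_mul, mul_comm,
    ← Set.ncard_eq_toFinset_card _ hS]

lemma sum_ncard_inter_of_partition {ι X : Type*} [Fintype ι] {A : ι → Set X} {S : Set X}
    (hS : S.Finite) (hdisj : ∀ i j, i ≠ j → Disjoint (A i) (A j))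
    (hcov : ∀ x ∈ S, ∃ i, x ∈ A i) : ∑ i, (A i ∩ S).ncard = S.ncard := by
  rw [sum_ncard_inter_eq hS (k := 1), one_mul]
  intro x hx
  obtain ⟨i, hi⟩ := hcov x hx
  rw [Set.ncard_eq_one]
  refine ⟨i, Set.eq_singleton_iff_unique_mem.2 ⟨hi, fun j hj ↦ ?_⟩⟩
  by_contra hne
  exact Set.disjoint_left.1 (hdisj j i hne) hj hi

theorem IsTreeDecomposition.numTreePieces_add_ncard_edgeSet {k l : ℕ} {T : Fin l → Graph α β}
    (hT : IsTreeDecomposition k l G T) (hV : G.vertexSet.Finite) (hE : G.edgeSet.Finite)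
    (hle : H ≤ G) :
    numTreePieces T H + H.edgeSet.ncard = k * H.vertexSet.ncard := by
  have hVH := hV.subset hle.vertexSet_mono
  have hEH := hE.subset hle.edgeSet_mono
  rw [← sum_ncard_inter_eq hVH fun v hv ↦ hT.vertex_count v (hle.vertexSet_mono hv),
    ← sum_ncard_inter_of_partition hEH hT.edge_disjoint
      fun e he ↦ hT.edge_cover e (hle.edgeSet_mono he),
    numTreePieces, ← Finset.sum_add_distrib]
  refine Finset.sum_congr rfl fun i _ ↦ ?_
  have hac : IsAcyclic (T i ⊓ H) := (hT.isTree i).2.mono inf_le_left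
  have := hac.ncard_edgeSet_add_ncard_components (hVH.subset Set.inter_subset_right)
  -- Both graphs lie in `G`, so they agree on shared edges and the infimum keeps all of these.
  rw [(Graph.Compatible.of_le_le (hT.le i) hle).edgeSet_inf, Graph.vertexSet_inf] at this
  omega

lemma IsConnected.ncard_components (hG : IsConnected G) : (components G).ncard = 1 := by
  obtain ⟨⟨x, hx⟩, h⟩ := hG
  rw [Set.ncard_eq_one]
  refine ⟨componentOf G x, Set.eq_singleton_iff_unique_mem.2
    ⟨componentOf_mem_components hx, ?_⟩⟩
  rintro _ ⟨y, hy, rfl⟩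
  exact componentOf_eq_of_reachable (h y hy x hx)

lemma IsTreeDecomposition.numTreePieces_self {k l : ℕ} {T : Fin l → Graph α β}
    (hT : IsTreeDecomposition k l G T) : numTreePieces T G = l := by
  have h : ∀ i, (components (T i ⊓ G)).ncard = 1 := fun i ↦ by
    rw [inf_eq_left.2 (hT.le i)]
    exact (hT.isTree i).1.ncard_components
  simp [numTreePieces, h]

/-- Trees have no loops, so an edge has two distinct ends. This makes properness apply to every
subgraph with an edge. -/
lemma IsTreeDecomposition.nontrivial_of_edgeSet_nonempty {k l : ℕ} {T : Fin l → Graph α β}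
    (hT : IsTreeDecomposition k l G T) (hle : H ≤ G) (hne : H.edgeSet.Nonempty) :
    H.vertexSet.Nontrivial := by
  obtain ⟨e, he⟩ := hne
  obtain ⟨x, y, hxy⟩ := H.exists_isLink_of_mem_edgeSet he
  refine ⟨x, hxy.left_mem, y, hxy.right_mem, ?_⟩
  rintro rfl
  obtain ⟨i, hi⟩ := hT.edge_cover e (hle.edgeSet_mono he)
  exact (hT.isTree i).2 e x x (((hT.le i).isLink_iff hi).2 (hxy.mono hle)) .refl

/-! ### Trees from forests -/

lemma Reachable.induce {C : Set α} (hC : C ∈ components G) {x y : α} (hx : x ∈ C)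
    (h : Reachable G x y) : Reachable (G.induce C) x y := by
  induction h with
  | refl => exact .refl
  | @tail b c hb hbc ih =>
    obtain ⟨e, he⟩ := hbc
    have hmem : ∀ z, Reachable G x z → z ∈ C := fun z hz ↦ by
      rw [← componentOf_eq_of_mem hC hx]
      exact hz
    exact ih.tail ⟨e, he, hmem b hb, hmem c (hb.tail ⟨e, he⟩)⟩

lemma IsAcyclic.isTree_induce (hG : IsAcyclic G) {C : Set α} (hC : C ∈ components G) :
    IsTree (G.induce C) := by
  refine ⟨⟨nonempty_of_mem_components hC, fun x hx y hy ↦ ?_⟩,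
    hG.mono (Graph.induce_le (subset_vertexSet_of_mem_components hC))⟩
  refine Reachable.induce hC hx ?_
  have : y ∈ componentOf G x := by
    rw [componentOf_eq_of_mem hC hx]
    exact hy
  exact this

/-- The trees of a family of forests partitioning the edges of `G` form a tree decomposition. -/
theorem exists_isTreeDecomposition_of_forests {k l : ℕ} (hV : G.vertexSet.Finite)
    (hE : G.edgeSet.Finite) (hl : G.edgeSet.ncard + l = k * G.vertexSet.ncard)
    {F : Fin k → Set β} (hdisj : ∀ i j, i ≠ j → Disjoint (F i) (F j))
    (hcov : ⋃ i, F i = G.edgeSet) (hF : ∀ i, IsAcyclic (G.restrict (F i))) :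
    ∃ T : Fin l → Graph α β, IsTreeDecomposition k l G T := by
  have hfin : ∀ i, Finite (components (G.restrict (F i))) := fun i ↦ finite_components hV
  -- `restrict` keeps all vertices, so isolated ones count as components; forest `i` has n - |F i|
  -- of them, in total kn - m = l.
  have hcard : Nat.card (Σ i, components (G.restrict (F i))) = l := by
    rw [Nat.card_sigma]
    simp only [Nat.card_coe_set_eq]
    have h : ∀ i, (F i ∩ G.edgeSet).ncard + (components (G.restrict (F i))).ncard =
        G.vertexSet.ncard := by
      intro i
      have := (hF i).ncard_edgeSet_add_ncard_components hV
      rwa [Graph.edgeSet_restrict, Graph.vertexSet_restrict, Set.inter_comm] at this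
    have hsum := Finset.sum_congr (rfl : (Finset.univ : Finset (Fin k)) = _) fun i _ ↦ h i
    rw [Finset.sum_add_distrib, sum_ncard_inter_of_partition hE hdisj
      (fun e he ↦ by simpa using hcov.symm.subset he), Finset.sum_const, Finset.card_univ,
      Fintype.card_fin, smul_eq_mul] at hsum
    omega
  let f : Fin l ≃ Σ i, components (G.restrict (F i)) := (Finite.equivFinOfCardEq hcard).symm
  refine ⟨fun j ↦ (G.restrict (F (f j).1)).induce (f j).2, fun j ↦ ?_, fun j ↦ ?_, ?_, ?_, ?_⟩
  · exact (Graph.induce_le (subset_vertexSet_of_mem_components (f j).2.2)).trans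
      Graph.restrict_le
  · exact (hF _).isTree_induce (f j).2.2
  · intro j j' hne
    rw [Set.disjoint_left]
    rintro e ⟨x, y, hxy, hx, hy⟩ ⟨x', y', hxy', hx', hy'⟩
    refine hne (f.injective ?_)
    generalize f j = p at *
    generalize f j' = p' at *
    obtain ⟨i, C, hC⟩ := p
    obtain ⟨i', C', hC'⟩ := p'
    obtain rfl : i = i' := by
      by_contra hii
      exact Set.disjoint_left.1 (hdisj i i' hii) hxy.1 hxy'.1
    obtain rfl : C = C' := by
      rw [← componentOf_eq_of_mem hC hx]
      obtain ⟨rfl, -⟩ | ⟨rfl, -⟩ := hxy.eq_and_eq_or_eq_and_eq hxy'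
      · exact componentOf_eq_of_mem hC' hx'
      · exact componentOf_eq_of_mem hC' hy'
    rfl
  · intro e he
    obtain ⟨i, hi⟩ := Set.mem_iUnion.1 (hcov.symm.subset he)
    obtain ⟨x, y, hxy⟩ := G.exists_isLink_of_mem_edgeSet he
    have hxy' : (G.restrict (F i)).IsLink e x y := ⟨hi, hxy⟩
    refine ⟨f.symm ⟨i, _, componentOf_mem_components hxy'.left_mem⟩, ?_⟩
    rw [Equiv.apply_symm_apply]
    exact ⟨x, y, hxy', mem_componentOf_self _ x, hxy'.reachable⟩
  · intro v hv
    -- `v` lies in exactly one component of each forest, so `g` enumerates the trees through `v`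
    -- without repetition.
    let g : Fin k → Fin l := fun i ↦
      f.symm ⟨i, componentOf (G.restrict (F i)) v, componentOf_mem_components hv⟩
    have hg : Function.Injective g := fun i i' h ↦ congrArg Sigma.fst (f.symm.injective h)
    have hrange : {j | v ∈ ((G.restrict (F (f j).1)).induce (f j).2).vertexSet} = Set.range g := by
      ext j
      constructor
      · intro hj
        refine ⟨(f j).1, f.symm_apply_eq.2 ?_⟩
        exact Sigma.ext rfl (heq_of_eq (Subtype.ext (componentOf_eq_of_mem (f j).2.2 hj)))
      · rintro ⟨i, rfl⟩
        have h : ∀ p : Σ i, components (G.restrict (F i)), p = f (g i) → v ∈ p.2.1 := by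
          simp only [g, Equiv.apply_symm_apply]
          rintro _ rfl
          exact mem_componentOf_self _ v
        exact h _ rfl
    rw [hrange, ← Nat.card_coe_set_eq, Nat.card_range_of_injective hg, Nat.card_fin]

end TreeDecomp

/-! ### The equivalence -/

open TreeDecomp in
theorem mainTheorem6 {α β : Type*} (k l : ℕ) (hkl : k ≤ l) (hlk : (l : ℤ) ≤ 2 * (k : ℤ) - 1)
    (G : Graph α β) (hV : G.vertexSet.Finite) (hE : G.edgeSet.Finite) :
    TreeDecomp.IsTight k l G ↔ TreeDecomp.IsProperLTk k l G := by
  constructor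
  · rintro ⟨hsparse, htight⟩
    obtain ⟨F, hdisj, hcov, hF⟩ := exists_forest_partition (k := k) hV hE fun H hle hne ↦ by
      have := hsparse H hle hne
      zify at hkl ⊢
      linarith
    obtain ⟨T, hT⟩ := exists_isTreeDecomposition_of_forests (l := l) hV hE
      (by zify; linarith) hdisj hcov hF
    refine ⟨T, hT, fun H hle hnt ↦ ?_⟩
    have hcount := hT.numTreePieces_add_ncard_edgeSet hV hE hle
    by_cases hne : H.edgeSet.Nonempty
    · have := hsparse H hle hne
      zify at hcount ⊢
      linarith
    -- Sparsity says nothing about edgeless subgraphs; here l ≤ 2k - 1 is used.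
    · rw [Set.not_nonempty_iff_eq_empty] at hne
      rw [hne, Set.ncard_empty, add_zero] at hcount
      have := (hV.subset hle.vertexSet_mono).to_subtype
      have h2 : 2 ≤ H.vertexSet.ncard :=
        Set.one_lt_ncard_iff_nontrivial.2 hnt
      have := Nat.mul_le_mul_left k h2
      omega
  · rintro ⟨T, hT, hproper⟩
    refine ⟨fun H hle hne ↦ ?_, ?_⟩
    · have hcount := hT.numTreePieces_add_ncard_edgeSet hV hE hle
      have := hproper H hle (hT.nontrivial_of_edgeSet_nonempty hle hne)
      zify at hcount this
      linarith
    · have hcount := hT.numTreePieces_add_ncard_edgeSet hV hE le_rfl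
      rw [hT.numTreePieces_self] at hcount
      zify at hcount
      linarith
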